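/- Let $d\in\mathbb{N}$ and equip $\mathbb{R}^d$ with the Euclidean norm. Let $B(x,\delta)$ denote the open ball with centre $x$ and radius $\delta$, and for bounded $E\subset\mathbb{R}^d$ and $r>0$ let $N_r(E)$ denote the least number of open balls of radius $r$ required to cover $E$. For $\theta\in(0,1)$, the Assouad spectrum of a set $F\subset\mathbb{R}^d$ at $\theta$ is $$\dim_A^\theta F=\inf\Bigl\{\alpha\in\mathbb{R}:\ (\exists C>0)(\forall\, 0<\delta\le 1)(\forall x\in F)\quad N_{\delta^{1/\theta}}\bigl(F\cap B(x,\delta)\bigr)\le C\Bigl(\frac{\delta}{\delta^{1/\theta}}\Bigr)^{\alpha}\Bigr\},$$ with the infimum taken in $[-\infty,\infty]$ (so that $\dim_A^\theta\varnothing=-\infty$). Let $\varphi\colon(0,1)\to[0,d]$ be any function. Then there exists a set $F\subset\mathbb{R}^d$ such that $\dim_A^\theta F=\varphi(\theta)$ for all $\theta\in(0,1)$ if and only if for all $0<\lambda<\theta<1$, $$0\le(1-\lambda)\varphi(\lambda)-(1-\theta)\varphi(\theta)\le(\theta-\lambda)\,\varphi\Bigl(\frac{\lambda}{\theta}\Bigr).$$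 -/

import Mathlib

namespace AssouadSpectra

open scoped ENNReal

/-- `ballCoveringNumber r E` is the least number of open balls of radius `r`, centred at arbitrary
points of the ambient space, needed to cover `E` (it is `⊤` if there is no finite such cover). -/
noncomputable def ballCoveringNumber {X : Type*} [PseudoMetricSpace X] (r : ℝ) (E : Set X) : ℕ∞ :=
  ⨅ (S : Set X) (_ : E ⊆ ⋃ c ∈ S, Metric.ball c r), S.encard

/-- The real number `α` is an admissible exponent for the set `F` at the parameter `θ`: for some
`C > 0`, the set `F ∩ B(x, δ)` is covered by at most `C * (δ / δ ^ (1 / θ)) ^ α` balls of radius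
`δ ^ (1 / θ)`, for all `0 < δ ≤ 1` and all `x ∈ F`. -/
def IsAdmissibleExponent {X : Type*} [PseudoMetricSpace X] (θ : ℝ) (F : Set X) (α : ℝ) : Prop :=
  ∃ C : ℝ, 0 < C ∧ ∀ δ : ℝ, 0 < δ → δ ≤ 1 → ∀ x ∈ F,
    (ballCoveringNumber (δ ^ (1 / θ)) (F ∩ Metric.ball x δ) : ℝ≥0∞) ≤
      ENNReal.ofReal (C * (δ / δ ^ (1 / θ)) ^ α)

/-- The Assouad spectrum of `F` at `θ`: the infimum, in the extended reals, of all admissible real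
exponents. -/
noncomputable def assouadSpectrum {X : Type*} [PseudoMetricSpace X] (θ : ℝ) (F : Set X) : EReal :=
  ⨅ (α : ℝ) (_ : IsAdmissibleExponent θ F α), (α : EReal)

end AssouadSpectra

/-!
Put `r = 2 ^ (-t)`. Up to constants in the exponent, `F` has Assouad spectrum `φ θ` at `θ` when
`(1 - θ) * φ θ` is the growth rate in `t` of the base-two logarithm of the covering numbers of
`F ∩ B(x, r ^ θ)` by balls of radius `r`. Enlarging the ball gives the first inequality, and passing
from the radius `r ^ lam` to `r` through the intermediate radius `r ^ θ` gives the second one.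

Conversely, divide `φ` by `d` and put `w θ = (1 - θ) * φ θ / d`. For an increasing `1`-Lipschitz
function `h`, let a binary digit in position `j` be free when the integer part of `h` jumps between
`j` and `j + 1`, and zero otherwise; the covering numbers of the resulting set between the scales
`2 ^ (-s)` and `2 ^ (-t)` are about `2 ^ (h t - h s)`. The two inequalities, together with `φ ≤ d`,
say that `h t = -(N * w (t / N))` is increasing, `1`-Lipschitz and satisfies
`h t - h (θ * t) ≤ t * w θ`, with equality at `t = N`. The union over all `N` of separated copies of
the `d`-th powers of these sets therefore has the required spectrum at every `θ` simultaneously.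
-/

namespace AssouadSpectra

open Metric
open scoped ENNReal

section CoveringNumber

variable {X : Type*} [PseudoMetricSpace X] {r ρ : ℝ} {E E' : Set X}

theorem ballCoveringNumber_le_card {S : Finset X} (hS : E ⊆ ⋃ c ∈ S, ball c r) :
    ballCoveringNumber r E ≤ S.card :=
  (iInf₂_le (S : Set X) hS).trans_eq (Set.encard_coe_eq_coe_finsetCard S)

theorem exists_finset_card_eq_ballCoveringNumber (h : ballCoveringNumber r E ≠ ⊤) :
    ∃ S : Finset X, E ⊆ ⋃ c ∈ S, ball c r ∧ (S.card : ℕ∞) = ballCoveringNumber r E := by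
  have hne : Nonempty {S : Set X // E ⊆ ⋃ c ∈ S, ball c r} := by
    by_contra hempty
    exact h (iInf₂_eq_top.2 fun S hS => (hempty ⟨S, hS⟩).elim)
  obtain ⟨⟨S, hS⟩, hmin⟩ := ENat.exists_eq_iInf
    fun S : {S : Set X // E ⊆ ⋃ c ∈ S, ball c r} => S.1.encard
  have hcard : S.encard = ballCoveringNumber r E := hmin.trans iInf_subtype
  have hfin : S.Finite := Set.encard_ne_top_iff.1 (hcard ▸ h)
  refine ⟨hfin.toFinset, by simpa only [Set.Finite.mem_toFinset] using hS, ?_⟩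
  rw [← hfin.encard_eq_coe_toFinset_card, hcard]

theorem ballCoveringNumber_mono (h : E ⊆ E') : ballCoveringNumber r E ≤ ballCoveringNumber r E' :=
  biInf_mono fun _ hS => Set.Subset.trans h hS

theorem ballCoveringNumber_anti_radius (h : ρ ≤ r) :
    ballCoveringNumber r E ≤ ballCoveringNumber ρ E :=
  biInf_mono fun _ hS => hS.trans (Set.iUnion₂_mono fun _ _ => ball_subset_ball h)

theorem ballCoveringNumber_empty : ballCoveringNumber r (∅ : Set X) = 0 :=
  nonpos_iff_eq_zero.1 (ballCoveringNumber_le_card (S := ∅) (Set.empty_subset _))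

theorem ballCoveringNumber_union_le :
    ballCoveringNumber r (E ∪ E') ≤ ballCoveringNumber r E + ballCoveringNumber r E' := by
  classical
  by_cases hE : ballCoveringNumber r E = ⊤
  · simp only [hE, top_add, le_top]
  by_cases hE' : ballCoveringNumber r E' = ⊤
  · simp only [hE', add_top, le_top]
  obtain ⟨S, hS, hcard⟩ := exists_finset_card_eq_ballCoveringNumber hE
  obtain ⟨S', hS', hcard'⟩ := exists_finset_card_eq_ballCoveringNumber hE'
  have hcover : E ∪ E' ⊆ ⋃ c ∈ S ∪ S', ball c r := by
    rw [Finset.set_biUnion_union]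
    exact Set.union_subset_union hS hS'
  rw [← hcard, ← hcard']
  exact (ballCoveringNumber_le_card hcover).trans (mod_cast Finset.card_union_le S S')

theorem ballCoveringNumber_biUnion_le {ι : Type*} (S : Finset ι) (U : ι → Set X) :
    ballCoveringNumber r (⋃ i ∈ S, U i) ≤ ∑ i ∈ S, ballCoveringNumber r (U i) := by
  classical
  induction S using Finset.induction_on with
  | empty => simp [ballCoveringNumber_empty]
  | insert i S hi ih =>
    rw [Finset.set_biUnion_insert, Finset.sum_insert hi]
    exact ballCoveringNumber_union_le.trans (by gcongr)

theorem ballCoveringNumber_le_mul {k : ℝ≥0∞} (hfin : ballCoveringNumber ρ E ≠ ⊤)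
    (h : ∀ c, (ballCoveringNumber r (E ∩ ball c ρ) : ℝ≥0∞) ≤ k) :
    (ballCoveringNumber r E : ℝ≥0∞) ≤ ballCoveringNumber ρ E * k := by
  obtain ⟨S, hS, hcard⟩ := exists_finset_card_eq_ballCoveringNumber hfin
  have hcover : E ⊆ ⋃ c ∈ S, E ∩ ball c ρ := by
    rw [← Set.inter_iUnion₂]
    exact Set.subset_inter subset_rfl hS
  have hsum : ballCoveringNumber r E ≤ ∑ c ∈ S, ballCoveringNumber r (E ∩ ball c ρ) :=
    (ballCoveringNumber_mono hcover).trans (ballCoveringNumber_biUnion_le S _)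
  calc (ballCoveringNumber r E : ℝ≥0∞)
      ≤ ∑ c ∈ S, (ballCoveringNumber r (E ∩ ball c ρ) : ℝ≥0∞) := by
        simpa only [← ENat.toENNRealRingHom_apply, map_sum] using ENat.toENNReal_mono hsum
    _ ≤ ∑ _c ∈ S, k := by gcongr with c; exact h c
    _ = ballCoveringNumber ρ E * k := by
        rw [Finset.sum_const, nsmul_eq_mul, ← hcard, ENat.toENNReal_coe]

theorem card_le_ballCoveringNumber {A : Finset X} (hA : (A : Set X) ⊆ E)
    (hsep : (A : Set X).Pairwise fun x y => 2 * r ≤ dist x y) :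
    (A.card : ℕ∞) ≤ ballCoveringNumber r E := by
  refine le_iInf₂ fun S hS => ?_
  have hcenter : ∀ x ∈ (A : Set X), ∃ c ∈ S, dist x c < r := fun x hx => by
    simpa only [Set.mem_iUnion₂, exists_prop, mem_ball] using hS (hA hx)
  choose! center hmem hdist using hcenter
  rw [← Set.encard_coe_eq_coe_finsetCard]
  refine Set.encard_le_encard_of_injOn hmem fun x hx y hy hxy => ?_
  by_contra hne
  have htri := dist_triangle_right x y (center x)
  have hyc := hdist y hy
  rw [← hxy] at hyc
  linarith [hsep hx hy hne, hdist x hx]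

end CoveringNumber

section Growth

variable {X : Type*} [PseudoMetricSpace X]

/-- `HasCoveringGrowth θ F b` says that, uniformly in `x ∈ F`, the intersection of `F` with the ball
of radius `r ^ θ` about `x` is covered by `O(r ^ (-b))` balls of radius `r`. Writing `r = 2 ^ (-t)`
makes all the estimates below additive in the exponents. -/
def HasCoveringGrowth (θ : ℝ) (F : Set X) (b : ℝ) : Prop :=
  ∃ K : ℝ, ∀ t : ℝ, 0 ≤ t → ∀ x ∈ F,
    (ballCoveringNumber (2 ^ (-t)) (F ∩ ball x (2 ^ (-(θ * t)))) : ℝ≥0∞) ≤ 2 ^ (b * t + K)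

theorem exists_eq_two_rpow {C : ℝ} (hC : 0 < C) : ∃ K : ℝ, C = 2 ^ K :=
  ⟨Real.logb 2 C, (Real.rpow_logb (by norm_num) (by norm_num) hC).symm⟩

theorem ofReal_two_rpow (x : ℝ) : ENNReal.ofReal (2 ^ x) = 2 ^ x := by
  rw [← ENNReal.ofReal_rpow_of_pos two_pos, ENNReal.ofReal_ofNat]

theorem isAdmissibleExponent_iff_hasCoveringGrowth {θ α : ℝ} {F : Set X} (hθ : 0 < θ) :
    IsAdmissibleExponent θ F α ↔ HasCoveringGrowth θ F ((1 - θ) * α) := by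
  have hradius (t : ℝ) : ((2 : ℝ) ^ (-(θ * t))) ^ (1 / θ) = 2 ^ (-t) := by
    rw [← Real.rpow_mul two_pos.le]
    congr 1
    field_simp
  have hbound (K t : ℝ) :
      ENNReal.ofReal (2 ^ K * ((2 : ℝ) ^ (-(θ * t)) / 2 ^ (-t)) ^ α) =
        2 ^ ((1 - θ) * α * t + K) := by
    rw [← Real.rpow_sub two_pos, ← Real.rpow_mul two_pos.le, ← Real.rpow_add two_pos,
      ofReal_two_rpow]
    congr 1
    ring
  constructor
  · rintro ⟨C, hC, h⟩
    obtain ⟨K, rfl⟩ := exists_eq_two_rpow hC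
    refine ⟨K, fun t ht x hx => ?_⟩
    have hδ : (2 : ℝ) ^ (-(θ * t)) ≤ 1 :=
      Real.rpow_le_one_of_one_le_of_nonpos one_le_two (neg_nonpos.2 (by positivity))
    simpa only [hradius, hbound] using h _ (by positivity) hδ x hx
  · rintro ⟨K, h⟩
    refine ⟨2 ^ K, by positivity, fun δ hδ hδ1 x hx => ?_⟩
    obtain ⟨t, rfl⟩ : ∃ t, δ = 2 ^ (-(θ * t)) := by
      obtain ⟨s, rfl⟩ := exists_eq_two_rpow hδ
      exact ⟨-s / θ, by field_simp⟩
    have ht : 0 ≤ t := by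
      have hexp : -(θ * t) ≤ 0 := by
        rwa [← Real.rpow_zero 2, Real.rpow_le_rpow_left_iff one_lt_two] at hδ1
      exact nonneg_of_mul_nonneg_right (neg_nonpos.1 hexp) hθ
    simpa only [hradius, hbound] using h t ht x hx

theorem isGLB_image_coe_ereal_iff {s : Set ℝ} {a : ℝ} :
    IsGLB (Real.toEReal '' s) (a : EReal) ↔ IsGLB s a := by
  refine ⟨fun h => ⟨fun x hx => EReal.coe_le_coe_iff.1 (h.1 ⟨x, hx, rfl⟩), fun c hc =>
    EReal.coe_le_coe_iff.1 (h.2 ?_)⟩, fun h => ⟨?_, fun c hc => ?_⟩⟩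
  · exact Set.forall_mem_image.2 fun x hx => EReal.coe_le_coe_iff.2 (hc hx)
  · exact Set.forall_mem_image.2 fun x hx => EReal.coe_le_coe_iff.2 (h.1 hx)
  · have hc' : ∀ x ∈ s, c ≤ x := Set.forall_mem_image.1 hc
    induction c with
    | bot => exact bot_le
    | coe c => exact EReal.coe_le_coe_iff.2 (h.2 fun x hx => EReal.coe_le_coe_iff.1 (hc' x hx))
    | top =>
      obtain ⟨x, hx⟩ := h.nonempty
      exact absurd (hc' x hx) (EReal.coe_lt_top x).not_ge

theorem assouadSpectrum_eq_coe_iff {θ φ : ℝ} {F : Set X} (hθ : 0 < θ) (hθ1 : θ < 1) :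
    assouadSpectrum θ F = φ ↔ IsGLB {b | HasCoveringGrowth θ F b} ((1 - θ) * φ) := by
  have hscale : {b | HasCoveringGrowth θ F b} =
      OrderIso.mulLeft₀ (1 - θ) (sub_pos.2 hθ1) '' {α | IsAdmissibleExponent θ F α} := by
    simp only [isAdmissibleExponent_iff_hasCoveringGrowth hθ]
    exact ((OrderIso.mulLeft₀ (1 - θ) (sub_pos.2 hθ1)).surjective.image_preimage
      {b | HasCoveringGrowth θ F b}).symm
  have hinf : assouadSpectrum θ F = sInf (Real.toEReal '' {α | IsAdmissibleExponent θ F α}) :=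
    sInf_image.symm
  rw [hscale, ← OrderIso.mulLeft₀_apply _ (sub_pos.2 hθ1), OrderIso.isGLB_image',
    ← isGLB_image_coe_ereal_iff, hinf]
  exact ⟨fun h => h ▸ isGLB_sInf _, fun h => h.sInf_eq⟩

theorem HasCoveringGrowth.mono_scale {lam θ b : ℝ} {F : Set X} (h : HasCoveringGrowth lam F b)
    (hle : lam ≤ θ) : HasCoveringGrowth θ F b := by
  obtain ⟨K, hK⟩ := h
  refine ⟨K, fun t ht x hx => le_trans ?_ (hK t ht x hx)⟩
  have hrad : (2 : ℝ) ^ (-(θ * t)) ≤ 2 ^ (-(lam * t)) := by gcongr; exact one_le_two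
  exact ENat.toENNReal_mono
    (ballCoveringNumber_mono (Set.inter_subset_inter_right F (ball_subset_ball hrad)))

end Growth

section Doubling

/-- A pseudometric space is doubling if every ball is covered by boundedly many balls of half its
radius. -/
def IsDoublingSpace (X : Type*) [PseudoMetricSpace X] : Prop :=
  ∃ K : ℕ, ∀ (z : X) (ρ : ℝ), 0 < ρ → ballCoveringNumber (ρ / 2) (ball z ρ) ≤ K

theorem isDoublingSpace_of_finiteDimensional (V : Type*) [NormedAddCommGroup V] [NormedSpace ℝ V]
    [FiniteDimensional ℝ V] : IsDoublingSpace V := by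
  classical
  have : ProperSpace V := FiniteDimensional.proper ℝ V
  obtain ⟨T, -, hTfin, hT⟩ := (isCompact_closedBall (0 : V) 1).finite_cover_balls
    (e := 1 / 2) (by norm_num)
  lift T to Finset V using hTfin
  refine ⟨T.card, fun z ρ hρ => ?_⟩
  have hcover : ball z ρ ⊆ ⋃ c ∈ T.image fun c => z + ρ • c, ball c (ρ / 2) := fun y hy => by
    have hunit : ρ⁻¹ • (y - z) ∈ closedBall (0 : V) 1 := by
      rw [mem_closedBall_zero_iff, norm_smul, norm_inv, Real.norm_of_nonneg hρ.le,
        inv_mul_le_iff₀ hρ, mul_one]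
      exact (mem_ball_iff_norm.1 hy).le
    obtain ⟨c, hc, hyc⟩ := Set.mem_iUnion₂.1 (hT hunit)
    refine Set.mem_iUnion₂.2 ⟨z + ρ • c, Finset.mem_image_of_mem _ hc, ?_⟩
    have hscale : y - (z + ρ • c) = ρ • (ρ⁻¹ • (y - z) - c) := by
      rw [smul_sub, smul_inv_smul₀ hρ.ne', sub_sub]
    rw [mem_ball_iff_norm] at hyc ⊢
    rw [hscale, norm_smul, Real.norm_of_nonneg hρ.le]
    calc ρ * ‖ρ⁻¹ • (y - z) - c‖ < ρ * (1 / 2) := by gcongr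
      _ = ρ / 2 := by ring
  exact (ballCoveringNumber_le_card hcover).trans (mod_cast Finset.card_image_le)

variable {X : Type*} [PseudoMetricSpace X] {F : Set X}

theorem ballCoveringNumber_inter_ball_le_mul {r ρ : ℝ} {k : ℝ≥0∞} {K : ℕ} {z : X}
    (hK : ballCoveringNumber (ρ / 2) (ball z ρ) ≤ K)
    (h : ∀ y ∈ F, (ballCoveringNumber r (F ∩ ball y ρ) : ℝ≥0∞) ≤ k) :
    (ballCoveringNumber r (F ∩ ball z ρ) : ℝ≥0∞) ≤ K * k := by
  have hK' : ballCoveringNumber (ρ / 2) (F ∩ ball z ρ) ≤ K :=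
    (ballCoveringNumber_mono Set.inter_subset_right).trans hK
  refine (ballCoveringNumber_le_mul (ρ := ρ / 2) (k := k)
    (hK'.trans_lt (ENat.natCast_lt_top K)).ne fun w => ?_).trans ?_
  · rcases (F ∩ ball z ρ ∩ ball w (ρ / 2)).eq_empty_or_nonempty with hempty | ⟨y, ⟨hyF, -⟩, hyw⟩
    · simp [hempty, ballCoveringNumber_empty]
    · refine le_trans (ENat.toENNReal_mono (ballCoveringNumber_mono ?_)) (h y hyF)
      rintro x ⟨⟨hxF, -⟩, hxw⟩
      refine ⟨hxF, ?_⟩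
      rw [mem_ball] at *
      linarith [dist_triangle_right x y w]
  · gcongr
    simpa using ENat.toENNReal_mono hK'

/-- Cover `F ∩ B(x, r ^ lam)` by balls of radius `r ^ θ`, then each of these by balls of radius
`r`. -/
theorem HasCoveringGrowth.trans (hX : IsDoublingSpace X) {lam θ b c : ℝ} (hθ : 0 < θ)
    (hb : HasCoveringGrowth (lam / θ) F b) (hc : HasCoveringGrowth θ F c) :
    HasCoveringGrowth lam F (θ * b + c) := by
  obtain ⟨K, hK⟩ := hX
  obtain ⟨K₁, h₁⟩ := hb
  obtain ⟨K₂, h₂⟩ := hc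
  refine ⟨K₁ + K + K₂, fun t ht x hx => ?_⟩
  have hcoarse := h₁ (θ * t) (by positivity) x hx
  rw [show lam / θ * (θ * t) = lam * t by field_simp] at hcoarse
  have hfine (z : X) :
      (ballCoveringNumber (2 ^ (-t)) (F ∩ ball z (2 ^ (-(θ * t)))) : ℝ≥0∞) ≤
        K * 2 ^ (c * t + K₂) :=
    ballCoveringNumber_inter_ball_le_mul (hK z _ (by positivity)) (h₂ t ht)
  have hK2 : (K : ℝ≥0∞) ≤ 2 ^ (K : ℝ) := by
    rw [ENNReal.rpow_natCast]
    exact_mod_cast Nat.lt_two_pow_self.le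
  have hfin : ballCoveringNumber (2 ^ (-(θ * t))) (F ∩ ball x (2 ^ (-(lam * t)))) ≠ ⊤ := by
    rw [← ENat.toENNReal_ne_top]
    exact (hcoarse.trans_lt (by finiteness)).ne
  calc (ballCoveringNumber (2 ^ (-t)) (F ∩ ball x (2 ^ (-(lam * t)))) : ℝ≥0∞)
      ≤ ballCoveringNumber (2 ^ (-(θ * t))) (F ∩ ball x (2 ^ (-(lam * t)))) *
          (K * 2 ^ (c * t + K₂)) :=
        ballCoveringNumber_le_mul hfin fun z => le_trans
          (ENat.toENNReal_mono (ballCoveringNumber_mono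
            (Set.inter_subset_inter_left _ Set.inter_subset_left))) (hfine z)
    _ ≤ 2 ^ (b * (θ * t) + K₁) * (2 ^ (K : ℝ) * 2 ^ (c * t + K₂)) := by gcongr
    _ = 2 ^ ((θ * b + c) * t + (K₁ + K + K₂)) := by
        simp only [← ENNReal.rpow_add _ _ two_ne_zero ENNReal.ofNat_ne_top]
        congr 1
        ring

theorem assouadSpectrum_weight_le {lam θ a b : ℝ} (hlam : 0 < lam) (hlt : lam < θ) (hθ : θ < 1)
    (ha : assouadSpectrum lam F = a) (hb : assouadSpectrum θ F = b) :
    (1 - θ) * b ≤ (1 - lam) * a := by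
  rw [assouadSpectrum_eq_coe_iff hlam (hlt.trans hθ)] at ha
  rw [assouadSpectrum_eq_coe_iff (hlam.trans hlt) hθ] at hb
  exact ha.mono hb fun _ h => h.mono_scale hlt.le

theorem assouadSpectrum_weight_sub_le (hX : IsDoublingSpace X) {lam θ a b c : ℝ} (hlam : 0 < lam)
    (hlt : lam < θ) (hθ : θ < 1) (ha : assouadSpectrum lam F = a) (hb : assouadSpectrum θ F = b)
    (hc : assouadSpectrum (lam / θ) F = c) :
    (1 - lam) * a - (1 - θ) * b ≤ (θ - lam) * c := by
  have hθ0 := hlam.trans hlt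
  rw [assouadSpectrum_eq_coe_iff hlam (hlt.trans hθ)] at ha
  rw [assouadSpectrum_eq_coe_iff hθ0 hθ] at hb
  rw [assouadSpectrum_eq_coe_iff (div_pos hlam hθ0) ((div_lt_one hθ0).2 hlt)] at hc
  have hlower : ((1 - lam) * a - (1 - θ) * b) / θ ∈
      lowerBounds {b | HasCoveringGrowth (lam / θ) F b} := fun u hu => by
    have hsub : (1 - lam) * a - θ * u ≤ (1 - θ) * b :=
      hb.2 fun v hv => sub_le_iff_le_add'.2 (ha.1 (hu.trans hX hθ0 hv))
    rw [div_le_iff₀' hθ0]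
    linarith
  calc (1 - lam) * a - (1 - θ) * b = θ * (((1 - lam) * a - (1 - θ) * b) / θ) := by field_simp
    _ ≤ θ * ((1 - lam / θ) * c) := by gcongr; exact hc.2 hlower
    _ = (θ - lam) * c := by field_simp

end Doubling

section BinaryDigits

open scoped Classical in
/-- The binary positions `l ≤ j < m` that are free for a number whose nonzero binary digits lie
in `J`. -/
noncomputable def freePositions (J : Set ℕ) (l m : ℕ) : Finset ℕ :=
  {j ∈ Finset.Ico l m | j ∈ J}

/-- The number in `[0, 1)` whose binary digits equal to `1` are at the positions in `T`, position
`j` having weight `2⁻¹ ^ (j + 1)`. -/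
noncomputable def binarySum (T : Finset ℕ) : ℝ :=
  ∑ j ∈ T, 2⁻¹ ^ (j + 1)

/-- The dyadic numbers whose nonzero binary digits all lie in positions belonging to `J`. -/
def digitSet (J : Set ℕ) : Set ℝ :=
  binarySum '' {T | (T : Set ℕ) ⊆ J}

/-- The finite part of `digitSet J` with digits in positions `l, …, m - 1`. -/
noncomputable def digitBlock (J : Set ℕ) (l m : ℕ) : Finset ℝ :=
  (freePositions J l m).powerset.image binarySum

variable {J : Set ℕ} {T T' : Finset ℕ} {l m : ℕ}

theorem mem_freePositions {j : ℕ} : j ∈ freePositions J l m ↔ (l ≤ j ∧ j < m) ∧ j ∈ J := by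
  simp only [freePositions, Finset.mem_filter, Finset.mem_Ico]

theorem freePositions_subset_range : freePositions J l m ⊆ Finset.range m := fun _ hj =>
  Finset.mem_range.2 (mem_freePositions.1 hj).1.2

theorem binarySum_nonneg (T : Finset ℕ) : 0 ≤ binarySum T :=
  Finset.sum_nonneg fun _ _ => by positivity

theorem binarySum_le (hT : ∀ j ∈ T, l ≤ j) : binarySum T ≤ 2⁻¹ ^ l := by
  have hsub : T ⊆ Finset.Ico l (T.sup id + 1) := fun j hj =>
    Finset.mem_Ico.2 ⟨hT j hj, Nat.lt_succ_of_le (Finset.le_sup (f := id) hj)⟩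
  calc binarySum T ≤ ∑ j ∈ Finset.Ico l (T.sup id + 1), (2⁻¹ : ℝ) ^ (j + 1) :=
        Finset.sum_le_sum_of_subset_of_nonneg hsub fun _ _ _ => by positivity
    _ = (∑ j ∈ Finset.Ico l (T.sup id + 1), (2⁻¹ : ℝ) ^ j) * 2⁻¹ := by
        simp only [pow_succ, Finset.sum_mul]
    _ ≤ 2⁻¹ ^ l / (1 - 2⁻¹) * 2⁻¹ := by
        gcongr
        exact geom_sum_Ico_le_of_lt_one (by norm_num) (by norm_num)
    _ = 2⁻¹ ^ l := by ring

theorem binarySum_eq_natCast_mul (hT : T ⊆ Finset.range m) :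
    binarySum T = (∑ j ∈ T, 2 ^ (m - 1 - j) : ℕ) * 2⁻¹ ^ m := by
  rw [binarySum, Nat.cast_sum, Finset.sum_mul]
  refine Finset.sum_congr rfl fun j hj => ?_
  obtain ⟨k, rfl⟩ := Nat.exists_eq_add_of_lt (Finset.mem_range.1 (hT hj))
  rw [show j + k + 1 - 1 - j = k by omega, show j + k + 1 = k + (j + 1) by ring, pow_add _ k,
    Nat.cast_pow, ← mul_assoc, ← mul_pow]
  norm_num

theorem two_inv_pow_le_abs_binarySum_sub (hT : T ⊆ Finset.range m) (hT' : T' ⊆ Finset.range m)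
    (hne : T ≠ T') : 2⁻¹ ^ m ≤ |binarySum T - binarySum T'| := by
  have hreflect : Set.InjOn (m - 1 - ·) (Finset.range m : Set ℕ) := fun i hi j hj hij => by grind
  have hsum {U : Finset ℕ} (hU : U ⊆ Finset.range m) :
      ∑ j ∈ U, 2 ^ (m - 1 - j) = ∑ k ∈ U.image (m - 1 - ·), 2 ^ k :=
    (Finset.sum_image (hreflect.mono hU)).symm
  have hinj : ∑ j ∈ T, 2 ^ (m - 1 - j) ≠ ∑ j ∈ T', 2 ^ (m - 1 - j) := fun heq => by
    rw [hsum hT, hsum hT'] at heq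
    exact hne (Finset.image_injOn_powerset_of_injOn hreflect (Finset.mem_powerset.2 hT)
      (Finset.mem_powerset.2 hT') (Finset.geomSum_injective le_rfl heq))
  rw [binarySum_eq_natCast_mul hT, binarySum_eq_natCast_mul hT', ← sub_mul, abs_mul,
    abs_of_pos (by positivity : (0 : ℝ) < 2⁻¹ ^ m)]
  refine le_mul_of_one_le_left (by positivity) ?_
  exact_mod_cast Int.one_le_abs (sub_ne_zero.2 (Nat.cast_injective.ne hinj))

theorem exists_binarySum_eq_of_mem_digitBlock {v : ℝ} (hv : v ∈ digitBlock J l m) :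
    ∃ T ⊆ freePositions J l m, binarySum T = v := by
  simpa only [digitBlock, Finset.mem_image, Finset.mem_powerset] using hv

theorem digitBlock_subset_digitSet : (digitBlock J l m : Set ℝ) ⊆ digitSet J := fun v hv => by
  obtain ⟨T, hT, rfl⟩ := exists_binarySum_eq_of_mem_digitBlock hv
  exact ⟨T, fun j hj => (mem_freePositions.1 (hT hj)).2, rfl⟩

theorem mem_Icc_of_mem_digitBlock {v : ℝ} (hv : v ∈ digitBlock J l m) :
    v ∈ Set.Icc 0 (2⁻¹ ^ l) := by
  obtain ⟨T, hT, rfl⟩ := exists_binarySum_eq_of_mem_digitBlock hv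
  exact ⟨binarySum_nonneg T, binarySum_le fun j hj => (mem_freePositions.1 (hT hj)).1.1⟩

theorem mem_Icc_of_mem_digitSet {y : ℝ} (hy : y ∈ digitSet J) : y ∈ Set.Icc 0 1 := by
  obtain ⟨T, -, rfl⟩ := hy
  exact ⟨binarySum_nonneg T, by simpa using binarySum_le (l := 0) fun j _ => j.zero_le⟩

theorem zero_mem_digitSet : (0 : ℝ) ∈ digitSet J :=
  ⟨∅, by simp, Finset.sum_empty⟩

theorem digitBlock_pairwise :
    (digitBlock J l m : Set ℝ).Pairwise fun v w => 2⁻¹ ^ m ≤ |v - w| := by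
  intro v hv w hw hvw
  obtain ⟨T, hT, rfl⟩ := exists_binarySum_eq_of_mem_digitBlock hv
  obtain ⟨T', hT', rfl⟩ := exists_binarySum_eq_of_mem_digitBlock hw
  exact two_inv_pow_le_abs_binarySum_sub (hT.trans freePositions_subset_range)
    (hT'.trans freePositions_subset_range) (ne_of_apply_ne binarySum hvw)

theorem card_digitBlock : (digitBlock J l m).card = 2 ^ (freePositions J l m).card := by
  rw [← Finset.card_powerset]
  refine Finset.card_image_of_injOn fun T hT T' hT' heq => ?_
  rw [Finset.mem_coe, Finset.mem_powerset] at hT hT'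
  by_contra hne
  have hsep := two_inv_pow_le_abs_binarySum_sub (hT.trans freePositions_subset_range)
    (hT'.trans freePositions_subset_range) hne
  rw [heq, sub_self, abs_zero] at hsep
  exact hsep.not_gt (by positivity)

theorem exists_mem_digitBlock_abs_sub_le (m : ℕ) {y : ℝ} (hy : y ∈ digitSet J) :
    ∃ z : ℤ, y ∈ Set.Icc (z * 2⁻¹ ^ l : ℝ) ((z + 1) * 2⁻¹ ^ l) ∧
      ∃ v ∈ digitBlock J l m, |y - (z * 2⁻¹ ^ l + v)| ≤ 2⁻¹ ^ m := by
  obtain ⟨T, hT, rfl⟩ := hy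
  have hsplit (k : ℕ) (U : Finset ℕ) :
      binarySum U = binarySum {j ∈ U | j < k} + binarySum {j ∈ U | k ≤ j} := by
    simpa only [binarySum, not_lt] using (Finset.sum_filter_add_sum_filter_not U (· < k) _).symm
  have hhead := binarySum_eq_natCast_mul (T := {j ∈ T | j < l}) (m := l) (by grind)
  have htail := binarySum_le (T := {j ∈ T | l ≤ j}) (l := l) (by simp)
  have hrest := binarySum_le (T := {j ∈ {j ∈ T | l ≤ j} | m ≤ j}) (l := m) (by simp)
  have hblock : binarySum {j ∈ {j ∈ T | l ≤ j} | j < m} ∈ digitBlock J l m :=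
    Finset.mem_image_of_mem _ (Finset.mem_powerset.2 fun j hj => mem_freePositions.2 (by
      simp only [Finset.mem_filter] at hj
      exact ⟨⟨hj.1.2, hj.2⟩, hT hj.1.1⟩))
  refine ⟨(∑ j ∈ T with j < l, 2 ^ (l - 1 - j) : ℕ), ?_, _, hblock, ?_⟩
  · rw [Int.cast_natCast, add_one_mul, ← hhead, hsplit l T]
    exact ⟨le_add_of_nonneg_right (binarySum_nonneg _), by gcongr⟩
  · rw [Int.cast_natCast, ← hhead, hsplit l T, hsplit m {j ∈ T | l ≤ j}, ← add_assoc,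
      add_sub_cancel_left, abs_of_nonneg (binarySum_nonneg _)]
    exact hrest

/-- The digits before `l` of a point of `digitSet J` within `2⁻¹ ^ l` of `x` form one of four
consecutive multiples of `2⁻¹ ^ l`. -/
theorem exists_finset_cover_digitSet (J : Set ℕ) (l m : ℕ) (x : ℝ) :
    ∃ S : Finset ℝ, S.card ≤ 2 ^ ((freePositions J l m).card + 2) ∧
      ∀ y ∈ digitSet J, |y - x| ≤ 2⁻¹ ^ l → ∃ s ∈ S, |y - s| ≤ 2⁻¹ ^ m := by
  obtain ⟨q, hq⟩ : ∃ q : ℤ, ⌊x * 2 ^ l⌋ = q := ⟨_, rfl⟩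
  refine ⟨Finset.image₂ (fun (z : ℤ) v => z * 2⁻¹ ^ l + v) (Finset.Icc (q - 2) (q + 1))
    (digitBlock J l m), ?_, fun y hy hyx => ?_⟩
  · refine (Finset.card_image₂_le _ _ _).trans_eq ?_
    rw [card_digitBlock, Int.card_Icc, show q + 1 + 1 - (q - 2) = 4 by ring, pow_add, mul_comm]
    rfl
  obtain ⟨z, ⟨hzy, hyz⟩, v, hv, hyv⟩ := exists_mem_digitBlock_abs_sub_le m hy
  refine ⟨_, Finset.mem_image₂_of_mem (Finset.mem_Icc.2 ⟨?_, ?_⟩) hv, hyv⟩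
  all_goals
    rw [abs_le] at hyx
    have hpos : (0 : ℝ) < 2⁻¹ ^ l := by positivity
    have hx : x = x * 2 ^ l * 2⁻¹ ^ l := by rw [mul_assoc, ← mul_pow]; norm_num
  · have hz : x * 2 ^ l ≤ z + 2 := by nlinarith
    have hfloor : ⌊x * 2 ^ l⌋ ≤ z + 2 := by exact_mod_cast (Int.floor_le _).trans hz
    linarith
  · have hz : ((z - 1 : ℤ) : ℝ) ≤ x * 2 ^ l := by push_cast; nlinarith
    linarith [Int.le_floor.2 hz]

end BinaryDigits

section DigitUnion

variable {ι : Type*} [Fintype ι]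

open scoped Classical in
/-- The finite set of points of `EuclideanSpace ℝ ι` whose `i`-th coordinate lies in `S i`. -/
noncomputable def boxFinset (S : ι → Finset ℝ) : Finset (EuclideanSpace ℝ ι) :=
  (Fintype.piFinset S).map (WithLp.equiv 2 (ι → ℝ)).symm.toEmbedding

/-- The union over `n : ℕ` of the translates by `(2 * n, …, 2 * n)` of the powers
`digitSet (J n) ^ ι`. Distinct translates are at distance at least `1` because `digitSet (J n)` lies
in `[0, 1]`. -/
def digitUnion (ι : Type*) (J : ℕ → Set ℕ) : Set (EuclideanSpace ℝ ι) :=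
  {x | ∃ n : ℕ, ∀ i, x i - 2 * n ∈ digitSet (J n)}

theorem mem_boxFinset {S : ι → Finset ℝ} {x : EuclideanSpace ℝ ι} :
    x ∈ boxFinset S ↔ ∀ i, x i ∈ S i := by
  simp [boxFinset, WithLp.equiv]

theorem card_boxFinset (S : ι → Finset ℝ) : (boxFinset S).card = ∏ i, (S i).card := by
  classical exact (Finset.card_map _).trans (Fintype.card_piFinset S)

theorem norm_lt_two_pow_card_mul {x : EuclideanSpace ℝ ι} {ρ : ℝ} (hρ : 0 < ρ)
    (hx : ∀ i, |x i| ≤ ρ) : ‖x‖ < 2 ^ Fintype.card ι * ρ := by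
  refine lt_of_pow_lt_pow_left₀ 2 (by positivity) ?_
  have hcard : (Fintype.card ι : ℝ) < 2 ^ Fintype.card ι := by exact_mod_cast Nat.lt_two_pow_self
  calc ‖x‖ ^ 2 = ∑ i, x i ^ 2 := EuclideanSpace.real_norm_sq_eq x
    _ ≤ ∑ _i : ι, ρ ^ 2 := by
        gcongr ∑ _i, ?_ with i
        exact sq_le_sq' (abs_le.1 (hx i)).1 (abs_le.1 (hx i)).2
    _ = Fintype.card ι * ρ ^ 2 := by rw [Finset.sum_const, nsmul_eq_mul, Finset.card_univ]
    _ < 2 ^ Fintype.card ι * ρ ^ 2 := by gcongr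
    _ ≤ (2 ^ Fintype.card ι) ^ 2 * ρ ^ 2 := by
        gcongr
        exact le_self_pow₀ (one_le_pow₀ one_le_two) two_ne_zero
    _ = (2 ^ Fintype.card ι * ρ) ^ 2 := (mul_pow _ _ _).symm

theorem abs_sub_le_dist (x y : EuclideanSpace ℝ ι) (i : ι) : |x i - y i| ≤ dist x y := by
  rw [dist_eq_norm]
  exact PiLp.norm_apply_le (x - y) i

variable {J : ℕ → Set ℕ} {n : ℕ} {x : EuclideanSpace ℝ ι}

theorem sub_mem_digitSet_of_dist_lt_one {y : EuclideanSpace ℝ ι}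
    (hx : ∀ i, x i - 2 * n ∈ digitSet (J n)) (hy : y ∈ digitUnion ι J) (hxy : dist y x < 1)
    (i : ι) : y i - 2 * n ∈ digitSet (J n) := by
  obtain ⟨k, hk⟩ := hy
  obtain ⟨hx0, hx1⟩ := mem_Icc_of_mem_digitSet (hx i)
  obtain ⟨hy0, hy1⟩ := mem_Icc_of_mem_digitSet (hk i)
  obtain ⟨hlow, hupp⟩ := abs_lt.1 ((abs_sub_le_dist y x i).trans_lt hxy)
  have hkn : (k : ℝ) < n + 1 := by linarith
  have hnk : (n : ℝ) < k + 1 := by linarith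
  norm_cast at hkn hnk
  obtain rfl : k = n := by omega
  exact hk i

theorem ballCoveringNumber_digitUnion_le (hx : ∀ i, x i - 2 * n ∈ digitSet (J n)) (l m : ℕ) :
    ballCoveringNumber (2 ^ Fintype.card ι * 2⁻¹ ^ m) (digitUnion ι J ∩ ball x (2⁻¹ ^ l)) ≤
      (2 ^ (((freePositions (J n) l m).card + 2) * Fintype.card ι) : ℕ) := by
  choose S hcard hS using fun i => exists_finset_cover_digitSet (J n) l m (x i - 2 * n)
  have hcover : digitUnion ι J ∩ ball x (2⁻¹ ^ l) ⊆
      ⋃ c ∈ boxFinset fun i => (S i).image (· + 2 * (n : ℝ)),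
        ball c (2 ^ Fintype.card ι * 2⁻¹ ^ m) := by
    rintro y ⟨hyU, hyx⟩
    have hyx1 : dist y x < 1 := hyx.trans_le (pow_le_one₀ (by norm_num) (by norm_num))
    have hnear (i : ι) : ∃ s ∈ S i, |y i - 2 * n - s| ≤ 2⁻¹ ^ m := by
      refine hS i _ (sub_mem_digitSet_of_dist_lt_one hx hyU hyx1 i) ?_
      rw [sub_sub_sub_cancel_right]
      exact (abs_sub_le_dist y x i).trans (mem_ball.1 hyx).le
    choose s hs hys using hnear
    refine Set.mem_iUnion₂.2 ⟨WithLp.toLp 2 fun i => s i + 2 * n,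
      mem_boxFinset.2 fun i => Finset.mem_image_of_mem _ (hs i), ?_⟩
    rw [mem_ball_iff_norm]
    refine norm_lt_two_pow_card_mul (by positivity) fun i => ?_
    simpa only [PiLp.sub_apply, ← sub_sub, sub_right_comm _ (s i)] using hys i
  refine (ballCoveringNumber_le_card hcover).trans ?_
  rw [card_boxFinset, pow_mul]
  exact_mod_cast Finset.prod_le_pow_card _ _ _ fun i _ => Finset.card_image_le.trans (hcard i)

theorem le_ballCoveringNumber_digitUnion (J : ℕ → Set ℕ) (n l m : ℕ) :
    (2 ^ ((freePositions (J n) l m).card * Fintype.card ι) : ℕ) ≤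
      ballCoveringNumber (2⁻¹ ^ (m + 1)) (digitUnion ι J ∩
        ball (WithLp.toLp 2 fun _ => 2 * n) (2 ^ Fintype.card ι * 2⁻¹ ^ l)) := by
  have hcard : (boxFinset fun _ : ι => (digitBlock (J n) l m).image (· + 2 * (n : ℝ))).card =
      2 ^ ((freePositions (J n) l m).card * Fintype.card ι) := by
    rw [card_boxFinset, Finset.prod_const, Finset.card_univ, pow_mul,
      Finset.card_image_of_injective _ (add_left_injective _), card_digitBlock]
  have hblock {x : EuclideanSpace ℝ ι}
      (hx : x ∈ boxFinset fun _ : ι => (digitBlock (J n) l m).image (· + 2 * (n : ℝ))) (i : ι) :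
      x i - 2 * n ∈ digitBlock (J n) l m := by
    obtain ⟨v, hv, hvx⟩ := Finset.mem_image.1 (mem_boxFinset.1 hx i)
    rwa [← hvx, add_sub_cancel_right]
  rw [← hcard]
  refine card_le_ballCoveringNumber (fun x hx => ⟨⟨n, fun i => ?_⟩, ?_⟩) fun x hx y hy hxy => ?_
  · exact digitBlock_subset_digitSet (hblock hx i)
  · rw [mem_ball_iff_norm]
    refine norm_lt_two_pow_card_mul (by positivity) fun i => ?_
    obtain ⟨h0, hl⟩ := mem_Icc_of_mem_digitBlock (hblock hx i)
    rwa [PiLp.sub_apply, abs_of_nonneg h0]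
  · obtain ⟨i, hi⟩ : ∃ i, x i ≠ y i := by
      by_contra! heq
      exact hxy (PiLp.ext heq)
    calc (2 : ℝ) * 2⁻¹ ^ (m + 1) = 2⁻¹ ^ m := by ring
      _ ≤ |x i - 2 * n - (y i - 2 * n)| :=
          digitBlock_pairwise (hblock hx i) (hblock hy i) (sub_left_injective.ne hi)
      _ ≤ dist x y := by
          rw [sub_sub_sub_cancel_right]
          exact abs_sub_le_dist x y i

end DigitUnion

section JumpSet

variable {h : ℝ → ℝ}

/-- The digit positions at which the integer part of `h` increases. -/
def jumpSet (h : ℝ → ℝ) : Set ℕ :=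
  {j | ⌊h j⌋ < ⌊h (j + 1)⌋}

theorem le_add_sub_of_lipschitzWith_one (hlip : LipschitzWith 1 h) {s t : ℝ} (hst : s ≤ t) :
    h t ≤ h s + (t - s) := by
  simpa [Real.dist_eq, abs_of_nonneg (sub_nonneg.2 hst)] using hlip.le_add_mul t s

theorem card_freePositions_jumpSet (hmono : Monotone h) (hlip : LipschitzWith 1 h) {l m : ℕ}
    (hlm : l ≤ m) : ((freePositions (jumpSet h) l m).card : ℤ) = ⌊h m⌋ - ⌊h l⌋ := by
  classical
  have hjump (j : ℕ) : (if j ∈ jumpSet h then (1 : ℤ) else 0) = ⌊h ↑(j + 1)⌋ - ⌊h j⌋ := by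
    push_cast
    have hlow : ⌊h j⌋ ≤ ⌊h (j + 1)⌋ := Int.floor_mono (hmono (by linarith))
    have hupp : ⌊h (j + 1)⌋ ≤ ⌊h j⌋ + 1 := by
      rw [← Int.floor_add_one]
      have hstep := le_add_sub_of_lipschitzWith_one hlip (by linarith : (j : ℝ) ≤ j + 1)
      exact Int.floor_mono (by linarith)
    split_ifs with hj <;> rw [jumpSet, Set.mem_ofPred_eq] at hj <;> omega
  calc ((freePositions (jumpSet h) l m).card : ℤ)
      = ∑ j ∈ Finset.Ico l m, if j ∈ jumpSet h then (1 : ℤ) else 0 := by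
        rw [← Finset.natCast_card_filter]
        congr
    _ = ∑ j ∈ Finset.Ico l m, (⌊h ↑(j + 1)⌋ - ⌊h j⌋) := Finset.sum_congr rfl fun j _ => hjump j
    _ = ⌊h m⌋ - ⌊h l⌋ := Finset.sum_Ico_sub (fun j => ⌊h j⌋) hlm

theorem card_freePositions_jumpSet_le (hmono : Monotone h) (hlip : LipschitzWith 1 h) {l m : ℕ}
    (hlm : l ≤ m) : ((freePositions (jumpSet h) l m).card : ℝ) ≤ h m - h l + 1 := by
  have hcard := congrArg (Int.cast : ℤ → ℝ) (card_freePositions_jumpSet hmono hlip hlm)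
  push_cast at hcard
  linarith [Int.floor_le (h m), Int.lt_floor_add_one (h l)]

theorem sub_le_card_freePositions_jumpSet (hmono : Monotone h) (hlip : LipschitzWith 1 h)
    (l m : ℕ) : h m - h l ≤ (freePositions (jumpSet h) l m).card + 1 := by
  rcases le_total l m with hlm | hml
  · have hcard := congrArg (Int.cast : ℤ → ℝ) (card_freePositions_jumpSet hmono hlip hlm)
    push_cast at hcard
    linarith [Int.floor_le (h l), Int.lt_floor_add_one (h m)]
  · have hanti : h m ≤ h l := hmono (Nat.cast_le.2 hml)
    exact (sub_nonpos.2 hanti).trans (by positivity)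

end JumpSet

section PrescribedGrowth

theorem two_inv_pow_eq_rpow (k : ℕ) : (2⁻¹ : ℝ) ^ k = 2 ^ (-(k : ℝ)) := by
  rw [Real.rpow_neg two_pos.le, Real.rpow_natCast, inv_pow]

theorem two_pow_mul_two_inv_pow_eq_rpow (c k : ℕ) :
    (2 : ℝ) ^ c * 2⁻¹ ^ k = 2 ^ ((c : ℝ) - k) := by
  rw [two_inv_pow_eq_rpow, ← Real.rpow_natCast, ← Real.rpow_add two_pos, sub_eq_add_neg]

theorem natCast_two_pow_toENNReal (k : ℕ) : (((2 ^ k : ℕ) : ℕ∞) : ℝ≥0∞) = 2 ^ (k : ℝ) := by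
  rw [ENNReal.rpow_natCast]
  push_cast
  rfl

variable {ι : Type*} [Fintype ι] {h : ℕ → ℝ → ℝ} {θ b t : ℝ}

theorem ballCoveringNumber_digitUnion_jumpSet_le (hmono : ∀ n, Monotone (h n))
    (hlip : ∀ n, LipschitzWith 1 (h n)) (hθ0 : 0 ≤ θ) (hθ1 : θ ≤ 1) (ht : 0 ≤ t) {n : ℕ}
    {x : EuclideanSpace ℝ ι} (hx : ∀ i, x i - 2 * n ∈ digitSet (jumpSet (h n))) :
    (ballCoveringNumber (2 ^ (-t))
      ((digitUnion ι fun n => jumpSet (h n)) ∩ ball x (2 ^ (-(θ * t)))) : ℝ≥0∞) ≤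
      2 ^ (Fintype.card ι * (h n t - h n (θ * t)) + Fintype.card ι * (Fintype.card ι + 5)) := by
  set d := Fintype.card ι with hd
  set l := ⌊θ * t⌋₊
  set m := ⌈t⌉₊ + d with hm
  have hl : (l : ℝ) ≤ θ * t := Nat.floor_le (by positivity)
  have hl' : θ * t ≤ l + 1 := (Nat.lt_floor_add_one _).le
  have htm : t + d ≤ m := by rw [hm, Nat.cast_add]; gcongr; exact Nat.le_ceil t
  have htm' : m ≤ t + 1 + d := by rw [hm, Nat.cast_add]; gcongr; exact (Nat.ceil_lt_add_one ht).le
  have hd0 : (0 : ℝ) ≤ d := Nat.cast_nonneg d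
  have hlm : l ≤ m := by
    rw [← Nat.cast_le (α := ℝ)]
    linarith [hd0, mul_le_of_le_one_left ht hθ1]
  have hcount : ((freePositions (jumpSet (h n)) l m).card : ℝ) ≤
      h n t - h n (θ * t) + (d + 3) := by
    linarith [card_freePositions_jumpSet_le (hmono n) (hlip n) hlm,
      le_add_sub_of_lipschitzWith_one (hlip n) (by linarith [hd0] : t ≤ m),
      le_add_sub_of_lipschitzWith_one (hlip n) hl]
  have hrad : (2 : ℝ) ^ d * 2⁻¹ ^ m ≤ 2 ^ (-t) := by
    rw [two_pow_mul_two_inv_pow_eq_rpow]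
    exact Real.rpow_le_rpow_of_exponent_le one_le_two (by linarith)
  have hball : (2 : ℝ) ^ (-(θ * t)) ≤ 2⁻¹ ^ l := by
    rw [two_inv_pow_eq_rpow]
    exact Real.rpow_le_rpow_of_exponent_le one_le_two (by linarith)
  refine (ENat.toENNReal_mono ((ballCoveringNumber_anti_radius hrad).trans
    ((ballCoveringNumber_mono (Set.inter_subset_inter_right _ (ball_subset_ball hball))).trans
      (ballCoveringNumber_digitUnion_le hx l m)))).trans ?_
  rw [natCast_two_pow_toENNReal, ← hd]
  refine ENNReal.rpow_le_rpow_of_exponent_le one_le_two ?_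
  push_cast
  calc ((freePositions (jumpSet (h n)) l m).card + 2 : ℝ) * d
      ≤ (h n t - h n (θ * t) + (d + 3) + 2) * d := by gcongr
    _ = d * (h n t - h n (θ * t)) + d * (d + 5) := by ring

theorem le_ballCoveringNumber_digitUnion_jumpSet (hmono : ∀ n, Monotone (h n))
    (hlip : ∀ n, LipschitzWith 1 (h n)) (hθ : 0 ≤ θ) (ht : 1 ≤ t) (n : ℕ) :
    2 ^ (Fintype.card ι * (h n t - h n (θ * t)) - Fintype.card ι * (Fintype.card ι + 4)) ≤
      (ballCoveringNumber (2 ^ (-t)) ((digitUnion ι fun n => jumpSet (h n)) ∩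
        ball (WithLp.toLp 2 fun _ => 2 * n) (2 ^ (-(θ * t)))) : ℝ≥0∞) := by
  set d := Fintype.card ι with hd
  obtain ⟨m, hm⟩ : ∃ m, ⌊t⌋₊ = m + 1 := Nat.exists_eq_add_one.2 (Nat.floor_pos.2 ht)
  have hmt : ((m + 1 : ℕ) : ℝ) ≤ t := hm ▸ Nat.floor_le (by positivity)
  have htm : t < (m + 1 : ℕ) + 1 := hm ▸ Nat.lt_floor_add_one t
  set l := ⌈θ * t⌉₊ + d with hl
  have hθl : θ * t + d ≤ l := by rw [hl, Nat.cast_add]; gcongr; exact Nat.le_ceil _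
  have hlθ : l ≤ θ * t + 1 + d := by
    rw [hl, Nat.cast_add]
    gcongr
    exact (Nat.ceil_lt_add_one (by positivity)).le
  have hcount : h n t - h n (θ * t) - (d + 4) ≤ (freePositions (jumpSet (h n)) l m).card := by
    push_cast at hmt htm
    linarith [sub_le_card_freePositions_jumpSet (hmono n) (hlip n) l m,
      le_add_sub_of_lipschitzWith_one (hlip n) (by linarith : (m : ℝ) ≤ t),
      le_add_sub_of_lipschitzWith_one (hlip n) (by linarith [(Nat.cast_nonneg d : (0 : ℝ) ≤ d)] :
        θ * t ≤ l)]
  have hrad : (2 : ℝ) ^ (-t) ≤ 2⁻¹ ^ (m + 1) := by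
    rw [two_inv_pow_eq_rpow]
    exact Real.rpow_le_rpow_of_exponent_le one_le_two (by linarith)
  have hball : (2 : ℝ) ^ d * 2⁻¹ ^ l ≤ 2 ^ (-(θ * t)) := by
    rw [two_pow_mul_two_inv_pow_eq_rpow]
    exact Real.rpow_le_rpow_of_exponent_le one_le_two (by linarith)
  refine le_trans ?_ (ENat.toENNReal_mono ((le_ballCoveringNumber_digitUnion _ n l m).trans
    ((ballCoveringNumber_mono (Set.inter_subset_inter_right _ (ball_subset_ball hball))).trans
      (ballCoveringNumber_anti_radius hrad))))
  rw [natCast_two_pow_toENNReal, ← hd]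
  refine ENNReal.rpow_le_rpow_of_exponent_le one_le_two ?_
  push_cast
  calc d * (h n t - h n (θ * t)) - d * (d + 4)
      = (h n t - h n (θ * t) - (d + 4)) * d := by ring
    _ ≤ (freePositions (jumpSet (h n)) l m).card * d := by gcongr

theorem hasCoveringGrowth_digitUnion (hmono : ∀ n, Monotone (h n))
    (hlip : ∀ n, LipschitzWith 1 (h n)) (hθ0 : 0 ≤ θ) (hθ1 : θ ≤ 1)
    (hb : ∀ n t, 0 ≤ t → Fintype.card ι * (h n t - h n (θ * t)) ≤ b * t) :
    HasCoveringGrowth θ (digitUnion ι fun n => jumpSet (h n)) b := by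
  refine ⟨Fintype.card ι * (Fintype.card ι + 5), fun t ht x ⟨n, hn⟩ =>
    (ballCoveringNumber_digitUnion_jumpSet_le hmono hlip hθ0 hθ1 ht hn).trans ?_⟩
  exact ENNReal.rpow_le_rpow_of_exponent_le one_le_two (by linarith [hb n t ht])

theorem HasCoveringGrowth.exists_card_mul_sub_le (hmono : ∀ n, Monotone (h n))
    (hlip : ∀ n, LipschitzWith 1 (h n)) (hθ : 0 ≤ θ)
    (hgrowth : HasCoveringGrowth θ (digitUnion ι fun n => jumpSet (h n)) b) :
    ∃ K : ℝ, ∀ n t, 1 ≤ t → Fintype.card ι * (h n t - h n (θ * t)) ≤ b * t + K := by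
  obtain ⟨K, hK⟩ := hgrowth
  refine ⟨K + Fintype.card ι * (Fintype.card ι + 4), fun n t ht => ?_⟩
  have hcenter : (WithLp.toLp 2 fun _ => 2 * n : EuclideanSpace ℝ ι) ∈
      digitUnion ι fun n => jumpSet (h n) :=
    ⟨n, fun i => by simpa only [sub_self] using zero_mem_digitSet⟩
  have hexp := (le_ballCoveringNumber_digitUnion_jumpSet hmono hlip hθ ht n).trans
    (hK t (by positivity) _ hcenter)
  rw [← ofReal_two_rpow, ← ofReal_two_rpow, ENNReal.ofReal_le_ofReal_iff (by positivity),
    Real.rpow_le_rpow_left_iff one_lt_two] at hexp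
  linarith

end PrescribedGrowth

section Profile

/-- The conditions that characterise the Assouad spectra of subsets of the real line. -/
structure IsAssouadProfile (φ : ℝ → ℝ) : Prop where
  le_one : ∀ θ, 0 < θ → θ < 1 → φ θ ≤ 1
  mul_anti : ∀ lam θ, 0 < lam → lam < θ → θ < 1 → (1 - θ) * φ θ ≤ (1 - lam) * φ lam
  sub_le : ∀ lam θ, 0 < lam → lam < θ → θ < 1 →
    (1 - lam) * φ lam - (1 - θ) * φ θ ≤ (θ - lam) * φ (lam / θ)

/-- The function `θ ↦ (1 - θ) * φ θ` on `(0, 1)`, extended by zero to `[1, ∞)`. -/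
noncomputable def weight (φ : ℝ → ℝ) (θ : ℝ) : ℝ :=
  if θ < 1 then (1 - θ) * φ θ else 0

/-- The function `t ↦ -(N * weight φ (t / N))`, frozen on `(-∞, 1]`. Its increment from `θ * N` to
`N` is `N * weight φ θ`, and no increment from `θ * t` to `t` exceeds `t * weight φ θ`. -/
noncomputable def profile (φ : ℝ → ℝ) (N : ℕ) (t : ℝ) : ℝ :=
  -(N * weight φ (max t 1 / N))

variable {φ : ℝ → ℝ} {lam θ : ℝ} {N : ℕ}

theorem weight_of_lt_one (h : θ < 1) : weight φ θ = (1 - θ) * φ θ :=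
  if_pos h

theorem weight_of_one_le (h : 1 ≤ θ) : weight φ θ = 0 :=
  if_neg h.not_gt

theorem profile_sub_mul_self (hN : 0 < N) (hθN : 1 ≤ θ * N) :
    profile φ N N - profile φ N (θ * N) = N * weight φ θ := by
  have hN' : (1 : ℝ) ≤ N := Nat.one_le_cast.2 hN
  rw [profile, profile, max_eq_left hN', max_eq_left hθN, div_self (by positivity),
    mul_div_cancel_right₀ _ (by positivity), weight_of_one_le le_rfl]
  ring

theorem isAssouadProfile_div_const {d : ℝ} (hd : 0 ≤ d) (hle : ∀ θ, 0 < θ → θ < 1 → φ θ ≤ d)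
    (h : ∀ lam θ, 0 < lam → lam < θ → θ < 1 →
      0 ≤ (1 - lam) * φ lam - (1 - θ) * φ θ ∧
        (1 - lam) * φ lam - (1 - θ) * φ θ ≤ (θ - lam) * φ (lam / θ)) :
    IsAssouadProfile fun θ => φ θ / d where
  le_one θ hθ hθ1 := div_le_one_of_le₀ (hle θ hθ hθ1) hd
  mul_anti lam θ hlam hlt hθ := by
    simp only [← mul_div_assoc]
    exact div_le_div_of_nonneg_right (sub_nonneg.1 (h lam θ hlam hlt hθ).1) hd
  sub_le lam θ hlam hlt hθ := by
    simp only [← mul_div_assoc, ← sub_div]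
    exact div_le_div_of_nonneg_right (h lam θ hlam hlt hθ).2 hd

namespace IsAssouadProfile

theorem nonneg (hφ : IsAssouadProfile φ) (hθ : 0 < θ) (hθ1 : θ < 1) : 0 ≤ φ θ := by
  have hanti := hφ.mul_anti (θ / 2) (1 / 2) (by linarith) (by linarith) (by norm_num)
  have hsub := hφ.sub_le (θ / 2) (1 / 2) (by linarith) (by linarith) (by norm_num)
  rw [show θ / 2 / (1 / 2) = θ by ring] at hsub
  exact nonneg_of_mul_nonneg_right ((sub_nonneg.2 hanti).trans hsub) (by linarith)

theorem weight_nonneg (hφ : IsAssouadProfile φ) (hθ : 0 < θ) : 0 ≤ weight φ θ := by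
  rcases lt_or_ge θ 1 with h | h
  · rw [weight_of_lt_one h]
    exact mul_nonneg (sub_nonneg.2 h.le) (hφ.nonneg hθ h)
  · rw [weight_of_one_le h]

theorem weight_le (hφ : IsAssouadProfile φ) (hθ : 0 < θ) (hθ1 : θ ≤ 1) :
    weight φ θ ≤ 1 - θ := by
  rcases hθ1.lt_or_eq with h | rfl
  · rw [weight_of_lt_one h]
    exact mul_le_of_le_one_right (sub_nonneg.2 hθ1) (hφ.le_one θ hθ h)
  · rw [weight_of_one_le le_rfl, sub_self]

theorem weight_anti (hφ : IsAssouadProfile φ) (hlam : 0 < lam) (hle : lam ≤ θ) :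
    weight φ θ ≤ weight φ lam := by
  rcases lt_or_ge θ 1 with h | h
  · rcases hle.lt_or_eq with hlt | rfl
    · rw [weight_of_lt_one h, weight_of_lt_one (hlt.trans h)]
      exact hφ.mul_anti lam θ hlam hlt h
    · rfl
  · rw [weight_of_one_le h]
    exact hφ.weight_nonneg hlam

theorem weight_sub_le (hφ : IsAssouadProfile φ) (hlam : 0 < lam) (hle : lam ≤ θ) :
    weight φ lam - weight φ θ ≤ θ * weight φ (lam / θ) := by
  have hθ := hlam.trans_le hle
  rcases hle.lt_or_eq with hlt | rfl
  · have hdiv : lam / θ < 1 := (div_lt_one hθ).2 hlt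
    rcases lt_or_ge θ 1 with h | h
    · rw [weight_of_lt_one h, weight_of_lt_one (hlt.trans h), weight_of_lt_one hdiv, ← mul_assoc,
        mul_one_sub, mul_div_cancel₀ _ hθ.ne']
      exact hφ.sub_le lam θ hlam hlt h
    · rw [weight_of_one_le h, sub_zero]
      exact (hφ.weight_anti (div_pos hlam hθ) (div_le_self hlam.le h)).trans
        (le_mul_of_one_le_left (hφ.weight_nonneg (div_pos hlam hθ)) h)
  · rw [sub_self]
    exact mul_nonneg hθ.le (hφ.weight_nonneg (div_pos hθ hθ))

theorem monotone_profile (hφ : IsAssouadProfile φ) (hN : 0 < N) : Monotone (profile φ N) :=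
  fun s t hst => neg_le_neg (mul_le_mul_of_nonneg_left
    (hφ.weight_anti (by positivity) (by gcongr)) N.cast_nonneg)

theorem profile_sub_le (hφ : IsAssouadProfile φ) (hN : 0 < N) {s t : ℝ} (hst : s ≤ t) :
    profile φ N t - profile φ N s ≤ max t 1 * weight φ (max s 1 / max t 1) := by
  have hN' : (0 : ℝ) < N := Nat.cast_pos.2 hN
  have hsub := hφ.weight_sub_le (lam := max s 1 / N) (θ := max t 1 / N) (by positivity)
    (by gcongr)
  rw [div_div_div_cancel_right₀ hN'.ne'] at hsub
  calc profile φ N t - profile φ N s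
      = N * (weight φ (max s 1 / N) - weight φ (max t 1 / N)) := by
        rw [profile, profile]
        ring
    _ ≤ N * (max t 1 / N * weight φ (max s 1 / max t 1)) := by gcongr
    _ = max t 1 * weight φ (max s 1 / max t 1) := by field_simp

theorem lipschitzWith_profile (hφ : IsAssouadProfile φ) (hN : 0 < N) :
    LipschitzWith 1 (profile φ N) := by
  have hstep {s t : ℝ} (hst : s ≤ t) : profile φ N t ≤ profile φ N s + (t - s) := by
    have hmax : max s 1 ≤ max t 1 := by gcongr
    have hpos : 0 < max t 1 := by positivity
    rw [← sub_le_iff_le_add']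
    calc profile φ N t - profile φ N s ≤ max t 1 * weight φ (max s 1 / max t 1) :=
          hφ.profile_sub_le hN hst
      _ ≤ max t 1 * (1 - max s 1 / max t 1) := by
          gcongr
          exact hφ.weight_le (by positivity) ((div_le_one hpos).2 hmax)
      _ = max t 1 - max s 1 := by field_simp
      _ ≤ t - s := by grind
  refine LipschitzWith.of_le_add fun s t => ?_
  rcases le_total t s with hts | hst
  · exact (hstep hts).trans_eq (by rw [Real.dist_eq, abs_of_nonneg (sub_nonneg.2 hts)])
  · exact (hφ.monotone_profile hN hst).trans (le_add_of_nonneg_right dist_nonneg)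

theorem profile_sub_mul_le (hφ : IsAssouadProfile φ) (hN : 0 < N) (hθ : 0 < θ) (hθ1 : θ ≤ 1)
    {t : ℝ} (ht : 0 ≤ t) : profile φ N t - profile φ N (θ * t) ≤ t * weight φ θ := by
  have hθt : θ * t ≤ t := mul_le_of_le_one_left ht hθ1
  rcases le_total t 1 with ht1 | ht1
  · rw [profile, profile, max_eq_right ht1, max_eq_right (hθt.trans ht1), sub_self]
    exact mul_nonneg ht (hφ.weight_nonneg hθ)
  · have hsub := hφ.profile_sub_le hN hθt
    rw [max_eq_left ht1] at hsub
    refine hsub.trans ?_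
    gcongr
    exact hφ.weight_anti hθ ((le_div_iff₀ (by positivity)).2 (le_max_left _ _))

variable {ι : Type*} [Fintype ι]

theorem hasCoveringGrowth (hφ : IsAssouadProfile φ) (hθ : 0 < θ) (hθ1 : θ ≤ 1) :
    HasCoveringGrowth θ (digitUnion ι fun n => jumpSet (profile φ (n + 1)))
      (Fintype.card ι * weight φ θ) :=
  hasCoveringGrowth_digitUnion (fun n => hφ.monotone_profile n.succ_pos)
    (fun n => hφ.lipschitzWith_profile n.succ_pos) hθ.le hθ1 fun n t ht => by
      rw [mul_assoc, mul_comm (weight φ θ)]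
      gcongr
      exact hφ.profile_sub_mul_le n.succ_pos hθ hθ1 ht

theorem card_mul_weight_le (hφ : IsAssouadProfile φ) (hθ : 0 < θ) {b : ℝ}
    (hb : HasCoveringGrowth θ (digitUnion ι fun n => jumpSet (profile φ (n + 1))) b) :
    Fintype.card ι * weight φ θ ≤ b := by
  obtain ⟨K, hK⟩ := hb.exists_card_mul_sub_le (fun n => hφ.monotone_profile n.succ_pos)
    (fun n => hφ.lipschitzWith_profile n.succ_pos) hθ.le
  have hlinear (n : ℕ) (hn : 1 ≤ θ * (n + 1 : ℕ)) :
      (n + 1 : ℕ) * (Fintype.card ι * weight φ θ - b) ≤ K := by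
    have h := hK n (n + 1 : ℕ) (Nat.one_le_cast.2 n.succ_pos)
    rw [profile_sub_mul_self n.succ_pos hn] at h
    linarith
  by_contra! hlt
  have hgap := sub_pos.2 hlt
  obtain ⟨n, hn⟩ := exists_nat_ge (max θ⁻¹ (K / (Fintype.card ι * weight φ θ - b)))
  obtain ⟨hnθ, hnK⟩ := max_le_iff.1 hn
  rw [inv_le_iff_one_le_mul₀' hθ] at hnθ
  rw [div_le_iff₀ hgap] at hnK
  have hn1 : 1 ≤ θ * (n + 1 : ℕ) := by push_cast; linarith
  have hbound := hlinear n hn1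
  push_cast at hbound
  linarith

theorem exists_assouadSpectrum_eq (hφ : IsAssouadProfile φ) (ι : Type*) [Fintype ι] :
    ∃ F : Set (EuclideanSpace ℝ ι), ∀ θ, 0 < θ → θ < 1 →
      assouadSpectrum θ F = ((Fintype.card ι * φ θ : ℝ) : EReal) := by
  refine ⟨digitUnion ι fun n => jumpSet (profile φ (n + 1)), fun θ hθ hθ1 => ?_⟩
  rw [assouadSpectrum_eq_coe_iff hθ hθ1, mul_left_comm, ← weight_of_lt_one hθ1]
  exact IsLeast.isGLB ⟨hφ.hasCoveringGrowth hθ hθ1.le, fun b hb => hφ.card_mul_weight_le hθ hb⟩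

end IsAssouadProfile

end Profile

end AssouadSpectra

theorem theoremA (d : ℕ) (φ : ℝ → ℝ)
    (hφ : ∀ θ ∈ Set.Ioo (0 : ℝ) 1, φ θ ∈ Set.Icc (0 : ℝ) d) :
    (∃ F : Set (EuclideanSpace ℝ (Fin d)), ∀ θ ∈ Set.Ioo (0 : ℝ) 1,
        AssouadSpectra.assouadSpectrum θ F = (φ θ : EReal)) ↔
      ∀ lam θ : ℝ, 0 < lam → lam < θ → θ < 1 →
        0 ≤ (1 - lam) * φ lam - (1 - θ) * φ θ ∧
          (1 - lam) * φ lam - (1 - θ) * φ θ ≤ (θ - lam) * φ (lam / θ) := by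
  constructor
  · rintro ⟨F, hF⟩ lam θ hlam hlt hθ
    have hspecLam := hF lam ⟨hlam, hlt.trans hθ⟩
    have hspecθ := hF θ ⟨hlam.trans hlt, hθ⟩
    have hspecDiv := hF (lam / θ)
      ⟨div_pos hlam (hlam.trans hlt), (div_lt_one (hlam.trans hlt)).2 hlt⟩
    exact ⟨sub_nonneg.2 (AssouadSpectra.assouadSpectrum_weight_le hlam hlt hθ hspecLam hspecθ),
      AssouadSpectra.assouadSpectrum_weight_sub_le
        (AssouadSpectra.isDoublingSpace_of_finiteDimensional _) hlam hlt hθ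
        hspecLam hspecθ hspecDiv⟩
  · intro h
    have hprofile := AssouadSpectra.isAssouadProfile_div_const d.cast_nonneg
      (fun θ hθ hθ1 => (hφ θ ⟨hθ, hθ1⟩).2) h
    obtain ⟨F, hF⟩ := hprofile.exists_assouadSpectrum_eq (Fin d)
    refine ⟨F, fun θ hθ => ?_⟩
    have hzero (hd : (d : ℝ) = 0) : φ θ = 0 := le_antisymm (hd ▸ (hφ θ hθ).2) (hφ θ hθ).1
    rw [hF θ hθ.1 hθ.2, Fintype.card_fin, mul_div_cancel_of_imp' hzero]
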